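/- Let $\gamma\in(0,1)$. There is a constant $C>0$, depending only on $\gamma$, with the following property. For each $n\ge 1$ let $G_n$ be a random weighted graph on the vertex set $\{1,\dots,n\}$, all defined on one probability space, whose edge weights are real random variables $\xi^{(n)}_{ij}=\xi^{(n)}_{ji}$ ($i\ne j$, possibly negative). Assume that the weights are uniformly bounded, i.e. there is $B$ with $|\xi^{(n)}_{ij}|\le B$ almost surely for all $n$ and $i<j$; that for each $n$ the variables $\xi^{(n)}_{ij}$, $i<j$, are independent (not necessarily identically distributed) with $\mathbb{E}\,\xi^{(n)}_{ij}=\mu_n$ and $\operatorname{Var}\xi^{(n)}_{ij}=\sigma_n^2$, where $\sigma_n>0$; and that for some real $p>6$ $$\sup_{n,\,i<j}\ \mathbb{E}\left|\frac{\xi^{(n)}_{ij}-\mu_n}{\sigma_n}\right|^p<\infty .$$ Assume moreover that $\mu_n\in(0,1-\gamma]$ for all $n$ and that $\frac{\mu_n}{\sigma_n}\left(\frac{n}{\log n}\right)^{1/2}\to\infty$ as $n\to\infty$. Let $L_n$ be the Laplacian matrix of $G_n$, with entries $-\xi^{(n)}_{ij}$ for $i\ne j$ and $\sum_{j\ne i}\xi^{(n)}_{ij}$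 on the diagonal, let $\lambda_1\ge\dots\ge\lambda_n$ be its eigenvalues with multiplicity, and let $e(G_n)=\sum_{i<j}\xi^{(n)}_{ij}$. Then for all sufficiently large $n$ (how large may depend on the sequence), $$\mathbb{P}\left[\ \sum_{i=1}^{k}\lambda_i\le e(G_n)+\binom{k+1}{2}\ \text{ for all } k=1,\dots,n\ \right]\ \ge\ 1-\exp(-C\mu_n n).$$ -/

import Mathlib

open MeasureTheory ProbabilityTheory Filter Finset

noncomputable section

/-- A weighted graph on the vertex set `Fin n`: symmetric real weights (possibly negative), the
weight of a non-edge being `0`. There are no loops: the diagonal values `weight u u` carry no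
meaning and are not used by any notion below. -/
structure WeightedGraph (n : ℕ) where
  /-- The weight of the pair `uv`. -/
  weight : Fin n → Fin n → ℝ
  symm : ∀ u v, weight u v = weight v u

namespace WeightedGraph

variable {n : ℕ}

/-- `e(G)`: the sum of the weights over unordered pairs of distinct vertices. -/
def totalWeight (G : WeightedGraph n) : ℝ :=
  ∑ e : Fin n × Fin n with e.1 < e.2, G.weight e.1 e.2

/-- The Laplacian matrix: `∑_{j ≠ u} w_{uj}` at `(u,u)` and `-w_{uv}` at `(u,v)` for `u ≠ v`. -/
def laplacian (G : WeightedGraph n) : Matrix (Fin n) (Fin n) ℝ :=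
  Matrix.of fun u v => if u = v then ∑ j ∈ univ.erase u, G.weight u j else -G.weight u v

theorem laplacian_isHermitian (G : WeightedGraph n) : G.laplacian.IsHermitian := by
  ext u v
  by_cases h : u = v
  · subst h; simp [laplacian]
  · simp [laplacian, h, Ne.symm h, G.symm u v]

/-- The Laplacian eigenvalues with multiplicity, in non-increasing order
(`eigenvalues₀` is antitone); index `i : Fin n` is the `(i+1)`-st largest one. -/
def laplacianEigenvalue (G : WeightedGraph n) (i : Fin n) : ℝ :=
  G.laplacian_isHermitian.eigenvalues₀ (Fin.cast (Fintype.card_fin n).symm i)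

/-- The sum of the `k` largest Laplacian eigenvalues (for `k ≤ n`). -/
def eigenvalueSum (G : WeightedGraph n) (k : ℕ) : ℝ :=
  ∑ i ∈ univ.filter (fun i : Fin n => (i : ℕ) < k), G.laplacianEigenvalue i

/-- The inequality of Brouwer's conjecture, for all `k = 1, …, n`. -/
def SatisfiesBrouwer (G : WeightedGraph n) : Prop :=
  ∀ k : ℕ, 1 ≤ k → k ≤ n → G.eigenvalueSum k ≤ G.totalWeight + ((k + 1).choose 2 : ℝ)

end WeightedGraph

end

/-!
Write `m` for the mean and `L = m (n I - J) + D - Z`, where `Z` is the matrix of centred weights and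
`D` the diagonal matrix of its row sums. If `P` is the spectral projection onto the top `k`
eigenvectors, the eigenvalue sum is `tr (L P)`. Here `tr (n I - J) P ≤ k n` as `J` is positive
semidefinite; `tr D P` is at most the sum of the positive entries of `D`, as `0 ≤ P u u ≤ 1`; and
`|tr Z P| ≤ √k ‖Z‖` in the Frobenius norm (`WeightedGraph.sum_eigenvalues_le`). The mean terms
satisfy Brouwer's inequality with room to spare, since
`m n² / 2 + k² / 2 - k m n = ((k - m n)² + m (1 - m) n²) / 2 ≥ γ m n² / 2` up to the lower order
terms `k / 2` and `-m n / 2`. So it is enough that the deviations are of size at most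
`(γ / 12) m n²`, in the sense of `HasSmallDeviations`
(`WeightedGraph.satisfiesBrouwer_of_deviation_le`).

The scale `m n²` is far above the typical size of these deviations, because `σ² = o(m² n)`. If `m n`
exceeds a constant (depending on the bound of the weights and on `γ`), Chernoff bounds, with a union
bound over the `2 ^ n` vertex sets on which the row sums may be positive, give a failure probability
of at most `exp (-n)`
(`IsCenteredFamily.measureReal_not_hasSmallDeviations_le_exp_neg`). If `m n` is below that
constant, `exp (-m n)` is bounded below, and Markov's inequality for the squared Frobenius norm of
`D - Z`, whose expectation is `O(σ² n²) = o(m² n³)`, suffices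
(`IsCenteredFamily.measureReal_not_hasSmallDeviations_le_div`). The resulting constant is `C = 1`.
-/

/-! ### Sums over edges -/

/-- The unordered pairs of distinct vertices, each represented by its increasing ordering. -/
abbrev Edge (n : ℕ) : Type := {e : Fin n × Fin n // e.1 < e.2}

/-- The number of endpoints of the edge `e` that lie in `S`, as a real number. -/
def endpointCount {n : ℕ} (S : Finset (Fin n)) (e : Edge n) : ℝ :=
  (if e.1.1 ∈ S then 1 else 0) + (if e.1.2 ∈ S then 1 else 0)

theorem endpointCount_nonneg {n : ℕ} (S : Finset (Fin n)) (e : Edge n) :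
    0 ≤ endpointCount S e := by
  unfold endpointCount; split_ifs <;> norm_num

theorem endpointCount_le_two {n : ℕ} (S : Finset (Fin n)) (e : Edge n) :
    endpointCount S e ≤ 2 := by
  unfold endpointCount; split_ifs <;> norm_num

theorem endpointCount_univ {n : ℕ} (e : Edge n) : endpointCount univ e = 2 := by
  norm_num [endpointCount]

theorem sum_edge {n : ℕ} (f : Fin n × Fin n → ℝ) :
    ∑ e : Edge n, f e.1 = ∑ u, ∑ v, if u < v then f (u, v) else 0 := by
  rw [← Fintype.sum_prod_type' (f := fun u v => if u < v then f (u, v) else 0), ← sum_filter]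
  exact (sum_subtype _ (by simp) f).symm

theorem sum_ne_eq_sum_edge {n : ℕ} (f : Fin n → Fin n → ℝ) :
    ∑ u, ∑ v, (if u = v then 0 else f u v)
      = ∑ e : Edge n, (f e.1.1 e.1.2 + f e.1.2 e.1.1) := by
  have h := sum_edge (n := n) fun e => f e.1 e.2 + f e.2 e.1
  rw [h]
  have h2 : ∑ u, ∑ v, (if u < v then f v u else 0)
      = ∑ u, ∑ v, (if v < u then f u v else 0) := sum_comm
  calc _ = ∑ u, ∑ v, ((if u < v then f u v else 0) + (if v < u then f u v else 0)) := by
        refine sum_congr rfl fun u _ => sum_congr rfl fun v _ => ?_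
        rcases lt_trichotomy u v with h | h | h
        · simp [h, h.ne, h.not_gt]
        · simp [h]
        · simp [h, h.ne', h.not_gt]
    _ = ∑ u, ∑ v, ((if u < v then f u v else 0) + (if u < v then f v u else 0)) := by
        simp only [sum_add_distrib, h2]
    _ = _ := by
        refine sum_congr rfl fun u _ => sum_congr rfl fun v _ => ?_
        split_ifs <;> simp

theorem card_edge_le (n : ℕ) : (Fintype.card (Edge n) : ℝ) ≤ (n : ℝ) ^ 2 := by
  have h := Fintype.card_subtype_le fun e : Fin n × Fin n => e.1 < e.2
  rw [Fintype.card_prod, Fintype.card_fin] at h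
  calc (Fintype.card (Edge n) : ℝ) ≤ ((n * n : ℕ) : ℝ) := by exact_mod_cast h
    _ = _ := by push_cast; ring

theorem card_edge_eq (n : ℕ) : (Fintype.card (Edge n) : ℝ) = (n : ℝ) * (n - 1) / 2 := by
  have h := sum_ne_eq_sum_edge (n := n) fun _ _ => (1 : ℝ)
  have h1 : ∀ u : Fin n, ∑ v : Fin n, (if u = v then (0 : ℝ) else 1) = n - 1 := by
    intro u
    have : ∀ v : Fin n, (if u = v then (0 : ℝ) else 1) = 1 - if u = v then 1 else 0 := by
      intro v; split_ifs <;> simp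
    simp [this, sum_sub_distrib]
  simp only [h1, sum_const, card_univ, nsmul_eq_mul, Fintype.card_fin] at h
  linarith

/-! ### Small deviations -/

/-- The deviations `x` of the edge weights from their mean are small at scale `r`: no set of
vertices has total degree deviation above `r`, the total weight does not drop by more than `r`,
and the Frobenius norm of the deviation matrix is at most `r / √n`. -/
def HasSmallDeviations {n : ℕ} (r : ℝ) (x : Edge n → ℝ) : Prop :=
  (∀ S, ∑ e, endpointCount S e * x e ≤ r) ∧ -r ≤ ∑ e, x e ∧ 2 * n * ∑ e, x e ^ 2 ≤ r ^ 2

/-- All three conditions follow from a bound on a single quadratic form, which is the squared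
Frobenius norm of the deviation of the Laplacian matrix. -/
theorem hasSmallDeviations_of_sq_le {n : ℕ} {r : ℝ} (hr : 0 ≤ r) {x : Edge n → ℝ}
    (h : n * (∑ u, (∑ e, endpointCount {u} e * x e) ^ 2 + 2 * ∑ e, x e ^ 2) ≤ r ^ 2) :
    HasSmallDeviations r x := by
  have hx : 0 ≤ n * ∑ e, x e ^ 2 := by positivity
  have hd : 0 ≤ n * ∑ u, (∑ e, endpointCount {u} e * x e) ^ 2 := by positivity
  have key : ∀ S, |∑ e, endpointCount S e * x e| ≤ r := by
    intro S
    have h1 : ∑ e, endpointCount S e * x e = ∑ u ∈ S, ∑ e, endpointCount {u} e * x e := by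
      rw [sum_comm]
      refine sum_congr rfl fun e _ => ?_
      rw [← sum_mul]
      simp [endpointCount, sum_add_distrib]
    have h2 : n * ∑ u, (∑ e, endpointCount {u} e * x e) ^ 2 ≤ r ^ 2 := by linarith
    refine abs_le_of_sq_le_sq (h2.trans' ?_) hr
    rw [h1]
    calc (∑ u ∈ S, ∑ e, endpointCount {u} e * x e) ^ 2
        ≤ #S * ∑ u ∈ S, (∑ e, endpointCount {u} e * x e) ^ 2 := sq_sum_le_card_mul_sum_sq
      _ ≤ n * ∑ u, (∑ e, endpointCount {u} e * x e) ^ 2 := by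
          gcongr
          · simpa using card_le_univ S
          · exact subset_univ S
  refine ⟨fun S => (abs_le.mp (key S)).2, ?_, by linarith⟩
  have h2 := (abs_le.mp (key univ)).1
  simp only [endpointCount_univ, ← mul_sum] at h2
  linarith

/-! ### Laplacian eigenvalue sums -/

namespace WeightedGraph

variable {n : ℕ}

/-- The deviation of the weight of an edge from the reference value `m`. -/
def deviation (G : WeightedGraph n) (m : ℝ) (e : Edge n) : ℝ := G.weight e.1.1 e.1.2 - m

theorem totalWeight_eq (G : WeightedGraph n) (m : ℝ) :
    G.totalWeight = m * (n * (n - 1) / 2) + ∑ e, G.deviation m e := by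
  have h : G.totalWeight = ∑ e : Edge n, G.weight e.1.1 e.1.2 :=
    sum_subtype _ (by simp) fun e : Fin n × Fin n => G.weight e.1 e.2
  rw [h]
  simp only [deviation, sum_sub_distrib, sum_const, card_univ, nsmul_eq_mul, card_edge_eq]
  ring

/-- The deviation of the degree of `u` from `m (n - 1)`. -/
def degreeDeviation (G : WeightedGraph n) (m : ℝ) (u : Fin n) : ℝ :=
  ∑ v, if u = v then 0 else G.weight u v - m

/-- Each edge contributes to the degrees of both of its endpoints. -/
theorem sum_degreeDeviation (G : WeightedGraph n) (m : ℝ) (S : Finset (Fin n)) :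
    ∑ u ∈ S, G.degreeDeviation m u = ∑ e, endpointCount S e * G.deviation m e := by
  have h := sum_ne_eq_sum_edge fun u v => (if u ∈ S then 1 else 0) * (G.weight u v - m)
  calc _ = ∑ u, ∑ v, (if u = v then 0 else (if u ∈ S then 1 else 0) * (G.weight u v - m)) := by
        rw [← sum_subset (subset_univ S)
          (fun u _ hu => sum_eq_zero fun v _ => by simp [hu])]
        refine sum_congr rfl fun u hu => ?_
        simp [degreeDeviation, hu]
    _ = _ := by
        rw [h]
        refine sum_congr rfl fun e _ => ?_
        rw [G.symm e.1.2 e.1.1, endpointCount, deviation]; ring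

theorem laplacian_apply (G : WeightedGraph n) (m : ℝ) (u v : Fin n) :
    G.laplacian u v = (if u = v then m * n + G.degreeDeviation m u else 0) - m
      - (if u = v then 0 else G.weight u v - m) := by
  by_cases h : u = v
  · subst h
    have h1 : ∑ j ∈ univ.erase u, G.weight u j
        = ∑ j ∈ univ.erase u, (m + (G.weight u j - m)) := by simp
    have h2 : ∑ j ∈ univ.erase u, (G.weight u j - m) = G.degreeDeviation m u := by
      rw [degreeDeviation, ← filter_ne univ u, sum_filter]
      exact sum_congr rfl fun v _ => by by_cases h : u = v <;> simp [h]
    have h3 : ((#(univ.erase u) : ℕ) : ℝ) = n - 1 := by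
      rw [card_erase_of_mem (mem_univ u), card_univ, Fintype.card_fin,
        Nat.cast_sub (Fin.pos u)]; simp
    simp only [laplacian, Matrix.of_apply, if_true]
    rw [h1, sum_add_distrib, h2, sum_const, nsmul_eq_mul, h3]; ring
  · simp [laplacian, h]; ring

/-- A sum of Laplacian eigenvalues is `tr (L P)` for the spectral projection `P`. In
`L = m (n I - J) + D - Z` the term `-m J` is negative semidefinite, the diagonal part `D` is
estimated by `0 ≤ P u u ≤ 1`, and `Z` by the Cauchy-Schwarz inequality, `P` having squared
Frobenius norm `#T`. -/
theorem sum_eigenvalues_le (G : WeightedGraph n) {m : ℝ} (hm : 0 ≤ m) (T : Finset (Fin n)) :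
    ∑ j ∈ T, G.laplacian_isHermitian.eigenvalues j ≤
      m * n * #T + ∑ u with 0 < G.degreeDeviation m u, G.degreeDeviation m u
        + √(#T * (2 * ∑ e, G.deviation m e ^ 2)) := by
  set hL := G.laplacian_isHermitian
  set b := hL.eigenvectorBasis
  set P : Fin n → Fin n → ℝ := fun u v => ∑ j ∈ T, b j u * b j v with hP
  set z : Fin n → Fin n → ℝ := fun u v => if u = v then 0 else G.weight u v - m with hz
  have horth : ∀ j l, ∑ u, b j u * b l u = if j = l then 1 else 0 := by
    intro j l
    have := orthonormal_iff_ite.mp b.orthonormal l j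
    simpa [PiLp.inner_apply, eq_comm] using this
  have hrow : ∀ u, ∑ j, b j u * b j u = 1 := by
    intro u
    have h := b.sum_sq_norm_inner_right (EuclideanSpace.single u (1 : ℝ))
    simpa [EuclideanSpace.inner_single_right, sq] using h
  have hlam : ∀ j, hL.eigenvalues j = ∑ u, ∑ v, G.laplacian u v * (b j u * b j v) := by
    intro j
    have h := hL.mulVec_eigenvectorBasis j
    have h1 : ∀ u, ∑ v, G.laplacian u v * b j v = hL.eigenvalues j * b j u := by
      intro u
      have := congrFun h u
      simpa [Matrix.mulVec, dotProduct] using this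
    calc hL.eigenvalues j = hL.eigenvalues j * ∑ u, b j u * b j u := by simp [horth]
      _ = ∑ u, b j u * (hL.eigenvalues j * b j u) := by
          rw [mul_sum]; exact sum_congr rfl fun u _ => by ring
      _ = _ := by
          refine sum_congr rfl fun u _ => ?_
          rw [← h1, mul_sum]; exact sum_congr rfl fun v _ => by ring
  have hsum : ∑ j ∈ T, hL.eigenvalues j = ∑ u, ∑ v, G.laplacian u v * P u v := by
    simp only [hlam, hP, mul_sum]
    rw [sum_comm]
    exact sum_congr rfl fun u _ => sum_comm
  have hexp : ∑ u, ∑ v, G.laplacian u v * P u v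
      = m * n * ∑ u, P u u + ∑ u, G.degreeDeviation m u * P u u
        - m * ∑ u, ∑ v, P u v - ∑ u, ∑ v, z u v * P u v := by
    simp only [G.laplacian_apply m, sub_mul, sum_sub_distrib, ite_mul, zero_mul, sum_ite_eq,
      mem_univ, if_true, add_mul, sum_add_distrib, mul_sum, hz]
  have htr : ∑ u, P u u = #T := by
    simp only [hP]; rw [sum_comm]; simp [horth]
  have hJ : 0 ≤ ∑ u, ∑ v, P u v := by
    have : ∑ u, ∑ v, P u v = ∑ j ∈ T, (∑ u, b j u) ^ 2 := by
      simp only [hP, sq, sum_mul_sum]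
      rw [sum_comm (s := T)]
      exact sum_congr rfl fun u _ => sum_comm
    rw [this]; positivity
  have hfrob : ∑ u, ∑ v, P u v ^ 2 = #T := by
    calc ∑ u, ∑ v, P u v ^ 2
        = ∑ u, ∑ j ∈ T, ∑ l ∈ T, ∑ v, b j u * b l u * (b j v * b l v) := by
          refine sum_congr rfl fun u _ => ?_
          simp only [hP, sq, sum_mul_sum]
          rw [sum_comm]
          refine sum_congr rfl fun j _ => ?_
          rw [sum_comm]
          exact sum_congr rfl fun l _ => sum_congr rfl fun v _ => by ring
      _ = ∑ j ∈ T, ∑ l ∈ T, (∑ u, b j u * b l u) * ∑ v, b j v * b l v := by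
          rw [sum_comm]
          refine sum_congr rfl fun j _ => ?_
          rw [sum_comm]
          simp only [sum_mul_sum]
      _ = #T := by simp [horth]
  have hdiag : ∑ u, G.degreeDeviation m u * P u u
      ≤ ∑ u with 0 < G.degreeDeviation m u, G.degreeDeviation m u := by
    rw [sum_filter]
    refine sum_le_sum fun u _ => ?_
    have h0 : 0 ≤ P u u := sum_nonneg fun j _ => mul_self_nonneg _
    have h1 : P u u ≤ 1 := by
      rw [← hrow u]
      exact sum_le_sum_of_subset_of_nonneg (subset_univ _) fun j _ _ => mul_self_nonneg _
    split_ifs with h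
    · nlinarith
    · nlinarith
  have hz2 : ∑ u, ∑ v, z u v ^ 2 = 2 * ∑ e, G.deviation m e ^ 2 := by
    have h := sum_ne_eq_sum_edge fun u v => (G.weight u v - m) ^ 2
    rw [mul_sum]
    calc _ = _ := by
          refine sum_congr rfl fun u _ => sum_congr rfl fun v _ => ?_
          simp only [hz]; split_ifs <;> simp
      _ = _ := h
      _ = _ := sum_congr rfl fun e _ => by rw [G.symm e.1.2 e.1.1, deviation]; ring
  have hcs : (∑ u, ∑ v, z u v * P u v) ^ 2 ≤ #T * (2 * ∑ e, G.deviation m e ^ 2) := by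
    have h := sum_mul_sq_le_sq_mul_sq (univ : Finset (Fin n × Fin n))
      (fun p => z p.1 p.2) (fun p => P p.1 p.2)
    simp only [Fintype.sum_prod_type] at h
    rw [hz2, hfrob] at h
    linarith
  have hZ := Real.abs_le_sqrt hcs
  rw [abs_le] at hZ
  rw [hsum, hexp, htr]
  have := mul_nonneg hm hJ
  linarith [hZ.1]

/-- Passes from the ordered eigenvalues `eigenvalues₀` to `eigenvalues`, whose indices match those
of the eigenvector basis. -/
theorem eigenvalueSum_eq (G : WeightedGraph n) {k : ℕ} (hk : k ≤ n) :
    ∃ T : Finset (Fin n), #T = k ∧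
      G.eigenvalueSum k = ∑ j ∈ T, G.laplacian_isHermitian.eigenvalues j := by
  let e : Fin n ≃ Fin n :=
    (finCongr (Fintype.card_fin n).symm).trans
      (Fintype.equivOfCardEq (Fintype.card_fin (Fintype.card (Fin n))))
  refine ⟨(univ.filter fun i : Fin n => (i : ℕ) < k).map e.toEmbedding, ?_, ?_⟩
  · rw [card_map]
    rw [Fin.card_filter_val_lt, min_eq_right hk]
  · rw [sum_map, eigenvalueSum]
    refine sum_congr rfl fun i _ => ?_
    simp [Matrix.IsHermitian.eigenvalues, laplacianEigenvalue, e]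

/-- The deviations, together with the lower order term `m n / 2`, cost at most `γ m n² / 2`, while
`m n² / 2 + k² / 2 - k m n = ((k - m n)² + m (1 - m) n²) / 2 ≥ γ m n² / 2`. -/
theorem satisfiesBrouwer_of_deviation_le (G : WeightedGraph n) {m γ : ℝ} (hγ : 0 < γ)
    (hm : 0 ≤ m) (hm1 : m ≤ 1 - γ) (hn : 2 / γ ≤ n)
    (h : HasSmallDeviations (γ / 12 * m * n ^ 2) (G.deviation m)) :
    G.SatisfiesBrouwer := by
  intro k _ hk
  obtain ⟨T, hT, hsum⟩ := G.eigenvalueSum_eq hk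
  have h0 := G.sum_eigenvalues_le hm T
  rw [sum_degreeDeviation, hT] at h0
  obtain ⟨hdeg, htot, hsq⟩ := h
  have h1 := hdeg {u | 0 < G.degreeDeviation m u}
  have hkn : (k : ℝ) ≤ n := by exact_mod_cast hk
  have h2 : √(k * (2 * ∑ e, G.deviation m e ^ 2)) ≤ γ / 12 * m * n ^ 2 := by
    apply Real.sqrt_le_iff.mpr
    refine ⟨by positivity, le_trans ?_ hsq⟩
    have : 0 ≤ ∑ e, G.deviation m e ^ 2 := by positivity
    nlinarith
  rw [hsum, G.totalWeight_eq m, Nat.cast_choose_two]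
  push_cast
  have h3 : 2 ≤ γ * n := by rwa [div_le_iff₀' hγ] at hn
  have h4 : 0 ≤ m * n * (γ * n - 2) := by
    have : 0 ≤ γ * n - 2 := by linarith
    positivity
  have h5 : 0 ≤ m * n ^ 2 * (1 - γ - m) := by
    have : 0 ≤ 1 - γ - m := by linarith
    positivity
  have h6 : (0 : ℝ) ≤ k := by positivity
  nlinarith [sq_nonneg ((k : ℝ) - m * n)]

end WeightedGraph

/-! ### Concentration of the deviations -/

section Probability

variable {Ω : Type*} [MeasurableSpace Ω] {P : Measure Ω} [IsProbabilityMeasure P]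

/-- Uses `exp x ≤ 1 + x + x²` for `|x| ≤ 1`. -/
theorem mgf_le_exp_of_integral_eq_zero {Y : Ω → ℝ} {t : ℝ} (hY : Measurable Y)
    (hb : ∀ᵐ ω ∂P, |t * Y ω| ≤ 1) (hint : MemLp Y 2 P) (h0 : ∫ ω, Y ω ∂P = 0) :
    mgf Y P t ≤ Real.exp (t ^ 2 * ∫ ω, Y ω ^ 2 ∂P) := by
  have h1 : Integrable Y P := hint.integrable (by norm_num)
  have h2 : Integrable (fun ω => Y ω ^ 2) P := hint.integrable_sq
  calc mgf Y P t ≤ ∫ ω, (1 + t * Y ω + t ^ 2 * Y ω ^ 2) ∂P := by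
        refine integral_mono_ae ?_ (by fun_prop) ?_
        · refine Integrable.of_bound (by fun_prop) (Real.exp 1) ?_
          filter_upwards [hb] with ω hω
          rw [Real.norm_eq_abs, Real.abs_exp]
          exact Real.exp_le_exp.mpr ((le_abs_self _).trans hω)
        · filter_upwards [hb] with ω hω
          have := (abs_le.mp (Real.abs_exp_sub_one_sub_id_le hω)).2
          nlinarith
    _ = 1 + t ^ 2 * ∫ ω, Y ω ^ 2 ∂P := by
        rw [integral_add (by fun_prop) (by fun_prop), integral_add (by fun_prop) (by fun_prop),
          integral_const_mul, integral_const_mul, h0]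
        simp
    _ ≤ _ := by linarith [Real.add_one_le_exp (t ^ 2 * ∫ ω, Y ω ^ 2 ∂P)]

/-- Uses `exp x ≤ 1 + 2 x` for `0 ≤ x ≤ 1`. -/
theorem mgf_le_exp_of_nonneg {Y : Ω → ℝ} {t : ℝ} (hY : Measurable Y) (ht : 0 ≤ t)
    (hnn : ∀ ω, 0 ≤ Y ω) (hb : ∀ᵐ ω ∂P, t * Y ω ≤ 1) (hint : Integrable Y P) :
    mgf Y P t ≤ Real.exp (2 * t * ∫ ω, Y ω ∂P) := by
  calc mgf Y P t ≤ ∫ ω, (1 + 2 * t * Y ω) ∂P := by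
        refine integral_mono_ae ?_ (by fun_prop) ?_
        · refine Integrable.of_bound (by fun_prop) (Real.exp 1) ?_
          filter_upwards [hb] with ω hω
          rw [Real.norm_eq_abs, Real.abs_exp]
          exact Real.exp_le_exp.mpr hω
        · filter_upwards [hb] with ω hω
          have h0 : 0 ≤ t * Y ω := mul_nonneg ht (hnn ω)
          have := (abs_le.mp (Real.abs_exp_sub_one_sub_id_le (abs_le.mpr ⟨by linarith, hω⟩))).2
          change Real.exp (t * Y ω) ≤ 1 + 2 * t * Y ω
          nlinarith
    _ = 1 + 2 * t * ∫ ω, Y ω ∂P := by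
        rw [integral_add (by fun_prop) (by fun_prop), integral_const_mul]
        simp
    _ ≤ _ := by linarith [Real.add_one_le_exp (2 * t * ∫ ω, Y ω ∂P)]

/-- The Chernoff bound for a sum of independent variables with a common bound on the moment
generating functions. -/
theorem measureReal_sum_ge_le {ι : Type*} [Fintype ι] {Y : ι → Ω → ℝ} {t v c : ℝ}
    (hY : ∀ i, Measurable (Y i)) (hind : iIndepFun Y P) (ht : 0 ≤ t)
    (hb : ∀ i, ∀ᵐ ω ∂P, t * Y i ω ≤ 1) (hmgf : ∀ i, mgf (Y i) P t ≤ Real.exp v) :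
    P.real {ω | c ≤ ∑ i, Y i ω} ≤ Real.exp (-(t * c) + Fintype.card ι * v) := by
  have hexp : ∀ i ∈ univ, Integrable (fun ω => Real.exp (t * Y i ω)) P := by
    intro i _
    refine Integrable.of_bound (by fun_prop) (Real.exp 1) ?_
    filter_upwards [hb i] with ω hω
    rw [Real.norm_eq_abs, Real.abs_exp]
    exact Real.exp_le_exp.mpr hω
  have h := measure_ge_le_exp_mul_mgf c ht (hind.integrable_exp_mul_sum hY hexp)
  rw [hind.mgf_sum hY] at h
  simp only [Finset.sum_apply] at h
  refine h.trans ?_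
  rw [Real.exp_add, neg_mul]
  gcongr
  calc ∏ i, mgf (Y i) P t ≤ ∏ _i : ι, Real.exp v :=
        prod_le_prod (fun i _ => mgf_nonneg) fun i _ => hmgf i
    _ = _ := by simp [Real.exp_nat_mul]

/-- The assumptions on the centred edge weights: measurable, independent, centred, with variance
`s`, and almost surely bounded by `b`. -/
structure IsCenteredFamily {ι : Type*} (X : ι → Ω → ℝ) (P : Measure Ω) (s b : ℝ) : Prop where
  measurable : ∀ i, Measurable (X i)
  indep : iIndepFun X P
  integral_eq_zero : ∀ i, ∫ ω, X i ω ∂P = 0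
  integral_sq : ∀ i, ∫ ω, X i ω ^ 2 ∂P = s
  bound : ∀ i, ∀ᵐ ω ∂P, |X i ω| ≤ b

namespace IsCenteredFamily

variable {ι : Type*} {X : ι → Ω → ℝ} {s b : ℝ}

theorem memLp (h : IsCenteredFamily X P s b) (i : ι) : MemLp (X i) 2 P :=
  MemLp.of_bound (h.measurable i).aestronglyMeasurable b (by simpa using h.bound i)

theorem integrable_sq (h : IsCenteredFamily X P s b) (i : ι) :
    Integrable (fun ω => X i ω ^ 2) P := (h.memLp i).integrable_sq

theorem memLp_sum [Fintype ι] (h : IsCenteredFamily X P s b) (a : ι → ℝ) :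
    MemLp (fun ω => ∑ i, a i * X i ω) 2 P :=
  memLp_finsetSum _ fun i _ => (h.memLp i).const_mul (a i)

theorem integral_sum_sq [Fintype ι] (h : IsCenteredFamily X P s b) (a : ι → ℝ) :
    ∫ ω, (∑ i, a i * X i ω) ^ 2 ∂P = (∑ i, a i ^ 2) * s := by
  have h0 : ∫ ω, ∑ i, a i * X i ω ∂P = 0 := by
    rw [integral_finsetSum _ fun i _ => ((h.memLp i).integrable (by norm_num)).const_mul (a i)]
    simp [integral_const_mul, h.integral_eq_zero]
  have hi : iIndepFun (fun i ω => a i * X i ω) P :=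
    h.indep.comp (fun i x => a i * x) fun i => by fun_prop
  have hv := IndepFun.variance_sum (μ := P) (s := univ) (X := fun i ω => a i * X i ω)
    (fun i _ => (h.memLp i).const_mul (a i)) fun i _ j _ hij => hi.indepFun hij
  rw [← variance_of_integral_eq_zero (h.memLp_sum a).aemeasurable h0, sum_mul]
  convert hv using 1
  · congr 1; ext ω; simp
  · refine sum_congr rfl fun i _ => ?_
    rw [variance_const_mul,
      variance_of_integral_eq_zero (h.measurable i).aemeasurable (h.integral_eq_zero i),
      h.integral_sq]

theorem measureReal_weighted_sum_ge_le [Fintype ι] (h : IsCenteredFamily X P s b)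
    {a : ι → ℝ} {t c : ℝ} (ha : ∀ i, |a i| ≤ 2) (ht : 0 ≤ t) (htb : 2 * t * b ≤ 1) :
    P.real {ω | c ≤ ∑ i, a i * X i ω} ≤
      Real.exp (-(t * c) + Fintype.card ι * (4 * t ^ 2 * s)) := by
  have hb : ∀ i, ∀ᵐ ω ∂P, |t * (a i * X i ω)| ≤ 1 := by
    intro i
    filter_upwards [h.bound i] with ω hω
    rw [abs_mul, abs_mul, abs_of_nonneg ht]
    calc t * (|a i| * |X i ω|) ≤ t * (2 * b) := by gcongr; exact ha i
      _ ≤ 1 := by linarith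
  have hm := h.measurable
  refine measureReal_sum_ge_le (fun i => (hm i).const_mul (a i))
    (h.indep.comp (fun i x => a i * x) fun i => by fun_prop) ht
    (fun i => (hb i).mono fun ω hω => (le_abs_self _).trans hω) fun i => ?_
  refine (mgf_le_exp_of_integral_eq_zero ((hm i).const_mul (a i)) (hb i)
    ((h.memLp i).const_mul (a i)) (by simp [integral_const_mul, h.integral_eq_zero])).trans ?_
  have hs : 0 ≤ s := by rw [← h.integral_sq i]; positivity
  have ha2 : a i ^ 2 ≤ 2 ^ 2 := sq_le_sq' (abs_le.mp (ha i)).1 (abs_le.mp (ha i)).2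
  simp only [mul_pow, integral_const_mul, h.integral_sq]
  apply Real.exp_le_exp.mpr
  calc t ^ 2 * (a i ^ 2 * s) ≤ t ^ 2 * (2 ^ 2 * s) := by gcongr
    _ = _ := by ring

theorem measureReal_sum_sq_ge_le [Fintype ι] (h : IsCenteredFamily X P s b)
    {t c : ℝ} (ht : 0 ≤ t) (htb : t * b ^ 2 ≤ 1) :
    P.real {ω | c ≤ ∑ i, X i ω ^ 2} ≤
      Real.exp (-(t * c) + Fintype.card ι * (2 * t * s)) := by
  have hb : ∀ i, ∀ᵐ ω ∂P, t * X i ω ^ 2 ≤ 1 := by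
    intro i
    filter_upwards [h.bound i] with ω hω
    calc t * X i ω ^ 2 ≤ t * b ^ 2 := by
          gcongr t * ?_
          exact sq_le_sq' (abs_le.mp hω).1 (abs_le.mp hω).2
      _ ≤ 1 := htb
  have hm := h.measurable
  refine measureReal_sum_ge_le (fun i => (hm i).pow_const 2)
    (h.indep.comp (fun i x => x ^ 2) fun i => by fun_prop) ht hb fun i => ?_
  rw [← h.integral_sq i]
  exact mgf_le_exp_of_nonneg ((hm i).pow_const 2) ht (fun ω => sq_nonneg _) (hb i)
    (h.integrable_sq i)

variable {n : ℕ} {X : Edge n → Ω → ℝ} {r : ℝ}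

/-- The exponential bound, effective when `n` times the mean is large. The `2 ^ n` vertex sets
are treated by a union bound. -/
theorem measureReal_not_hasSmallDeviations_le_exp (h : IsCenteredFamily X P s b) (hs : 0 ≤ s)
    (hn : 0 < n) {t t' : ℝ} (ht : 0 ≤ t) (htb : 2 * t * b ≤ 1)
    (ht' : 0 ≤ t') (htb' : t' * b ^ 2 ≤ 1) :
    P.real {ω | ¬ HasSmallDeviations r fun e => X e ω} ≤
      (2 ^ n + 1) * Real.exp (-(t * r) + n ^ 2 * (4 * t ^ 2 * s))
        + Real.exp (-(t' * (r ^ 2 / (2 * n))) + n ^ 2 * (2 * t' * s)) := by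
  have hlin : ∀ a : Edge n → ℝ, (∀ e, |a e| ≤ 2) → P.real {ω | r ≤ ∑ e, a e * X e ω} ≤
      Real.exp (-(t * r) + n ^ 2 * (4 * t ^ 2 * s)) := by
    intro a ha
    refine (h.measureReal_weighted_sum_ge_le ha ht htb).trans ?_
    gcongr
    exact card_edge_le n
  have hquad : P.real {ω | r ^ 2 / (2 * n) ≤ ∑ e, X e ω ^ 2} ≤
      Real.exp (-(t' * (r ^ 2 / (2 * n))) + n ^ 2 * (2 * t' * s)) := by
    refine (h.measureReal_sum_sq_ge_le ht' htb').trans ?_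
    gcongr
    exact card_edge_le n
  have hsub : {ω | ¬ HasSmallDeviations r fun e => X e ω} ⊆
      ((⋃ S ∈ (univ : Finset (Finset (Fin n))), {ω | r ≤ ∑ e, endpointCount S e * X e ω})
        ∪ {ω | r ≤ ∑ e, (-1) * X e ω}) ∪ {ω | r ^ 2 / (2 * n) ≤ ∑ e, X e ω ^ 2} := by
    intro ω hω
    by_contra hc
    simp only [Set.mem_union, Set.mem_iUnion, Set.mem_ofPred_eq, not_or, not_exists, not_le,
      ← mul_sum] at hc
    obtain ⟨⟨h1, h2⟩, h3⟩ := hc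
    refine hω ⟨fun S => (h1 S (mem_univ S)).le, by linarith, ?_⟩
    rw [lt_div_iff₀ (by positivity)] at h3
    linarith
  refine (measureReal_mono hsub).trans ((measureReal_union_le _ _).trans ?_)
  refine add_le_add ((measureReal_union_le _ _).trans ?_) hquad
  rw [add_mul, one_mul]
  refine add_le_add ((measureReal_biUnion_finset_le _ _).trans ?_) (hlin _ fun e => by norm_num)
  calc ∑ S : Finset (Fin n), P.real {ω | r ≤ ∑ e, endpointCount S e * X e ω}
      ≤ ∑ _S : Finset (Fin n), Real.exp (-(t * r) + n ^ 2 * (4 * t ^ 2 * s)) :=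
        sum_le_sum fun S _ => hlin _ fun e => by
          rw [abs_of_nonneg (endpointCount_nonneg S e)]; exact endpointCount_le_two S e
    _ = _ := by simp

/-- The second moment bound, effective when `n` times the mean stays bounded. -/
theorem measureReal_not_hasSmallDeviations_le_div (h : IsCenteredFamily X P s b) (hs : 0 ≤ s)
    (hr : 0 < r) :
    P.real {ω | ¬ HasSmallDeviations r fun e => X e ω} ≤ n * (6 * n ^ 2 * s) / r ^ 2 := by
  set Q : Ω → ℝ := fun ω =>
    n * (∑ u, (∑ e, endpointCount {u} e * X e ω) ^ 2 + 2 * ∑ e, X e ω ^ 2) with hQ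
  have hi1 : ∀ u : Fin n, Integrable (fun ω => (∑ e, endpointCount {u} e * X e ω) ^ 2) P :=
    fun u => (h.memLp_sum _).integrable_sq
  have hi1' := integrable_finsetSum univ fun u _ => hi1 u
  have hi2 := integrable_finsetSum (univ : Finset (Edge n)) fun e _ => h.integrable_sq e
  have hint : Integrable Q P := (hi1'.add (hi2.const_mul 2)).const_mul n
  have hEQ : ∫ ω, Q ω ∂P ≤ n * (6 * n ^ 2 * s) := by
    simp only [hQ]
    rw [integral_const_mul, integral_add hi1' (hi2.const_mul 2), integral_const_mul,
      integral_finsetSum _ fun u _ => hi1 u, integral_finsetSum _ fun e _ => h.integrable_sq e]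
    simp only [h.integral_sum_sq, h.integral_sq, sum_const, card_univ, nsmul_eq_mul, ← sum_mul]
    have hc := card_edge_le n
    have h1 : ∑ u : Fin n, ∑ e : Edge n, endpointCount {u} e ^ 2 ≤ 4 * n ^ 2 := by
      rw [sum_comm]
      have h2 : ∀ e : Edge n, ∑ u : Fin n, endpointCount {u} e ^ 2 ≤ 4 := by
        intro e
        calc ∑ u : Fin n, endpointCount {u} e ^ 2 ≤ ∑ u : Fin n, 2 * endpointCount {u} e := by
              refine sum_le_sum fun u _ => ?_
              nlinarith [endpointCount_nonneg {u} e, endpointCount_le_two {u} e]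
          _ = 4 := by
              rw [← mul_sum]; simp [endpointCount, sum_add_distrib]; norm_num
      calc _ ≤ ∑ _e : Edge n, (4 : ℝ) := sum_le_sum fun e _ => h2 e
        _ ≤ _ := by simp only [sum_const, card_univ, nsmul_eq_mul]; linarith
    have h3 := mul_le_mul_of_nonneg_right h1 hs
    have h4 := mul_le_mul_of_nonneg_right hc hs
    gcongr
    linarith
  have hmarkov := mul_meas_ge_le_integral_of_nonneg
    (Eventually.of_forall fun ω => by positivity : 0 ≤ᵐ[P] Q) hint (r ^ 2)
  rw [le_div_iff₀' (by positivity)]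
  refine le_trans ?_ (hmarkov.trans hEQ)
  refine mul_le_mul_of_nonneg_left (measureReal_mono fun ω hω => ?_) (sq_nonneg r)
  by_contra hc
  exact hω (hasSmallDeviations_of_sq_le hr.le (not_le.mp hc).le)

end IsCenteredFamily

end Probability

/-! ### Choice of the parameters -/

section Assembly

variable {Ω : Type*} [MeasurableSpace Ω] {P : Measure Ω} [IsProbabilityMeasure P]

/-- The exponential bound with its parameters chosen, at scale `δ m n²`. -/
theorem IsCenteredFamily.measureReal_not_hasSmallDeviations_le_exp_neg {n : ℕ}
    {X : Edge n → Ω → ℝ} {s b m δ : ℝ} (h : IsCenteredFamily X P s b) (hs : 0 ≤ s) (hn : 1 ≤ n)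
    (hm : 0 < m) (hδ : 0 < δ) (hb : 0 < b) (hsm : s ≤ δ ^ 2 / 48 * (m ^ 2 * n))
    (hbm : 12 * b ≤ δ * m * n) :
    P.real {ω | ¬ HasSmallDeviations (δ * m * n ^ 2) fun e => X e ω} ≤ Real.exp (-n) := by
  have hn0 : (0 : ℝ) < n := by exact_mod_cast hn
  have hn1 : (1 : ℝ) ≤ n := by exact_mod_cast hn
  have hx : 0 < δ * m * n := by positivity
  -- At the parameter `6 / (δ m n)` the linear Chernoff exponent is `-6 n` plus a variance term
  -- of at most `3 n`.
  have h1 := h.measureReal_not_hasSmallDeviations_le_exp hs hn (r := δ * m * n ^ 2)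
    (t := 6 / (δ * m * n)) (t' := 1 / b ^ 2) (by positivity)
    (by rw [mul_div_assoc', div_mul_eq_mul_div, div_le_one hx]; linarith)
    (by positivity) (by rw [one_div, inv_mul_cancel₀ (by positivity)])
  have e1 : -(6 / (δ * m * n) * (δ * m * n ^ 2)) + n ^ 2 * (4 * (6 / (δ * m * n)) ^ 2 * s)
      ≤ -(3 * n) := by
    have : n ^ 2 * (4 * (6 / (δ * m * n)) ^ 2 * s) ≤
        n ^ 2 * (4 * (6 / (δ * m * n)) ^ 2 * (δ ^ 2 / 48 * (m ^ 2 * n))) := by gcongr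
    have e2 : n ^ 2 * (4 * (6 / (δ * m * n)) ^ 2 * (δ ^ 2 / 48 * (m ^ 2 * n))) = 3 * n := by
      field_simp; norm_num
    have e3 : 6 / (δ * m * n) * (δ * m * n ^ 2) = 6 * n := by field_simp
    linarith
  have e4 : -(1 / b ^ 2 * ((δ * m * n ^ 2) ^ 2 / (2 * n))) + n ^ 2 * (2 * (1 / b ^ 2) * s)
      ≤ -(3 * n) := by
    have e5 : n ^ 2 * (2 * (1 / b ^ 2) * s) ≤
        n ^ 2 * (2 * (1 / b ^ 2) * (δ ^ 2 / 48 * (m ^ 2 * n))) := by gcongr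
    have e6 : (12 * b) ^ 2 ≤ (δ * m * n) ^ 2 := by gcongr
    have e7 : 144 ≤ (δ * m * n) ^ 2 / b ^ 2 := by
      rw [le_div_iff₀ (by positivity)]; linarith
    have e8 : 1 / b ^ 2 * ((δ * m * n ^ 2) ^ 2 / (2 * n)) = (δ * m * n) ^ 2 / b ^ 2 * n / 2 := by
      field_simp
    have e9 : n ^ 2 * (2 * (1 / b ^ 2) * (δ ^ 2 / 48 * (m ^ 2 * n)))
        = (δ * m * n) ^ 2 / b ^ 2 * n / 24 := by
      field_simp; norm_num
    nlinarith
  calc _ ≤ (2 ^ n + 1) * Real.exp (-(3 * n)) + Real.exp (-(3 * n)) := by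
        refine h1.trans ?_
        gcongr
    _ = (2 ^ n + 2) * Real.exp (-(3 * n)) := by ring
    _ ≤ Real.exp (2 * n) * Real.exp (-(3 * n)) := by
        gcongr
        have h2 : (2 : ℝ) ≤ 2 ^ n := by simpa using pow_le_pow_right₀ one_le_two hn
        have h3 : (2 : ℝ) ^ n ≤ Real.exp n := by
          rw [← Real.exp_one_pow]
          gcongr
          linarith [Real.add_one_le_exp 1]
        have h4 : Real.exp (2 * n) = Real.exp n * Real.exp n := by rw [← Real.exp_add]; ring_nf
        nlinarith
    _ = Real.exp (-n) := by rw [← Real.exp_add]; ring_nf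

/-- The growth condition on the mean, in the form `σ² = o(μ² n)`; the logarithm is not needed. -/
theorem eventually_sq_le_of_tendsto {μ σ : ℕ → ℝ} (hσ : ∀ n : ℕ, 1 ≤ n → 0 < σ n)
    (h : Tendsto (fun n : ℕ => μ n / σ n * √((n : ℝ) / Real.log n)) atTop atTop)
    {η : ℝ} (hη : 0 < η) : ∀ᶠ n : ℕ in atTop, σ n ^ 2 ≤ η * (μ n ^ 2 * n) := by
  have hlog : ∀ᶠ n : ℕ in atTop, 1 ≤ Real.log n :=
    (Real.tendsto_log_atTop.comp tendsto_natCast_atTop_atTop).eventually_ge_atTop 1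
  filter_upwards [h.eventually_ge_atTop √(1 / η), hlog, eventually_ge_atTop 1] with n h1 h2 hn
  have hs := hσ n hn
  have h3 : 1 / η ≤ μ n ^ 2 / σ n ^ 2 * (n / Real.log n) := by
    have := Real.sqrt_le_iff.mp (le_refl √(1 / η))
    have h4 := pow_le_pow_left₀ (Real.sqrt_nonneg _) h1 2
    rwa [Real.sq_sqrt (by positivity), mul_pow, Real.sq_sqrt (by positivity), div_pow] at h4
  have h5 : 1 / η ≤ μ n ^ 2 / σ n ^ 2 * n :=
    h3.trans (by gcongr; exact div_le_self (by positivity) h2)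
  rw [div_mul_eq_mul_div, div_le_div_iff₀ hη (by positivity)] at h5
  linarith

end Assembly

theorem theorem1 (γ : ℝ) (hγ : γ ∈ Set.Ioo (0 : ℝ) 1) :
    ∃ C : ℝ, 0 < C ∧
      ∀ (Ω : Type*) [MeasurableSpace Ω] (P : Measure Ω) [IsProbabilityMeasure P]
        (G : (n : ℕ) → Ω → WeightedGraph n) (μ σ : ℕ → ℝ) (p : ℝ),
        -- the edge weights are random variables
        (∀ (n : ℕ) (i j : Fin n), i < j → Measurable fun ω => (G n ω).weight i j) →
        -- they are uniformly bounded
        (∃ B : ℝ, ∀ (n : ℕ) (i j : Fin n), i < j → ∀ᵐ ω ∂P, |(G n ω).weight i j| ≤ B) →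
        -- for each `n`, they are independent
        (∀ n : ℕ, iIndepFun
          (fun (e : {e : Fin n × Fin n // e.1 < e.2}) ω => (G n ω).weight e.1.1 e.1.2) P) →
        -- mean, variance and moments
        (∀ (n : ℕ) (i j : Fin n), i < j → ∫ ω, (G n ω).weight i j ∂P = μ n) →
        (∀ (n : ℕ) (i j : Fin n), i < j →
          variance (fun ω => (G n ω).weight i j) P = σ n ^ 2) →
        (∀ n : ℕ, 1 ≤ n → 0 < σ n) →
        6 < p →
        (∃ K : ℝ, ∀ (n : ℕ) (i j : Fin n), i < j →
          ∫ ω, |((G n ω).weight i j - μ n) / σ n| ^ p ∂P ≤ K) →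
        -- assumptions on the size of the mean
        (∀ n : ℕ, 1 ≤ n → μ n ∈ Set.Ioc 0 (1 - γ)) →
        Tendsto (fun n : ℕ => μ n / σ n * Real.sqrt ((n : ℝ) / Real.log n)) atTop atTop →
        ∀ᶠ n : ℕ in atTop,
          1 - Real.exp (-(C * μ n * n)) ≤ P.real {ω | (G n ω).SatisfiesBrouwer} := by
  refine ⟨1, one_pos, ?_⟩
  intro Ω _ P _ G μ σ p hmeas ⟨B, hB⟩ hind hmean hvar hσ _ _ hμ htend
  obtain ⟨hγ0, hγ1⟩ := hγ
  set δ : ℝ := γ / 12 with hδ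
  set b : ℝ := |B| + 1 with hb
  have hδ0 : 0 < δ := by positivity
  have hb0 : 0 < b := by positivity
  filter_upwards [eventually_sq_le_of_tendsto hσ htend (η := δ ^ 2 / 48) (by positivity),
    eventually_sq_le_of_tendsto hσ htend
      (η := δ ^ 2 / 6 * Real.exp (-(12 * b / δ))) (by positivity),
    eventually_ge_atTop 1, tendsto_natCast_atTop_atTop.eventually_ge_atTop (2 / γ)]
    with n hs1 hs2 hn hnγ
  obtain ⟨hm0, hm1⟩ := hμ n hn
  have hn0 : (0 : ℝ) < n := by exact_mod_cast hn
  have hfam : IsCenteredFamily (fun e ω => (G n ω).deviation (μ n) e) P (σ n ^ 2) b := by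
    have hint : ∀ e : Edge n, Integrable (fun ω => (G n ω).weight e.1.1 e.1.2) P := fun e =>
      Integrable.of_bound (hmeas n _ _ e.2).aestronglyMeasurable B (hB n _ _ e.2)
    refine ⟨fun e => (hmeas n _ _ e.2).sub_const _,
      (hind n).comp (fun _ x => x - μ n) fun _ => by fun_prop, fun e => ?_, fun e => ?_,
      fun e => ?_⟩
    · simp only [WeightedGraph.deviation]
      rw [integral_sub (hint e) (by fun_prop), hmean n _ _ e.2]
      simp
    · rw [← hvar n _ _ e.2, variance_eq_integral (hmeas n _ _ e.2).aemeasurable,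
        hmean n _ _ e.2]
      rfl
    · filter_upwards [hB n _ _ e.2] with ω hω
      have h1 := abs_sub ((G n ω).weight e.1.1 e.1.2) (μ n)
      rw [abs_of_pos hm0] at h1
      change |(G n ω).weight e.1.1 e.1.2 - μ n| ≤ b
      linarith [le_abs_self B]
  have hbad : P.real {ω | ¬ HasSmallDeviations (δ * μ n * n ^ 2) ((G n ω).deviation (μ n))}
      ≤ Real.exp (-(1 * μ n * n)) := by
    rcases le_total (12 * b) (δ * μ n * n) with hcase | hcase
    · refine (hfam.measureReal_not_hasSmallDeviations_le_exp_neg (sq_nonneg _) hn hm0 hδ0 hb0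
        hs1 hcase).trans (Real.exp_le_exp.mpr ?_)
      nlinarith
    · -- Here `μ n * n` is bounded, so a failure probability tending to `0` suffices.
      refine (hfam.measureReal_not_hasSmallDeviations_le_div (sq_nonneg _)
        (by positivity)).trans ?_
      calc n * (6 * n ^ 2 * σ n ^ 2) / (δ * μ n * n ^ 2) ^ 2
          ≤ n * (6 * n ^ 2 * (δ ^ 2 / 6 * Real.exp (-(12 * b / δ)) * (μ n ^ 2 * n)))
            / (δ * μ n * n ^ 2) ^ 2 := by gcongr
        _ = Real.exp (-(12 * b / δ)) := by field_simp
        _ ≤ Real.exp (-(1 * μ n * n)) := by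
            apply Real.exp_le_exp.mpr
            rw [neg_le_neg_iff, le_div_iff₀ hδ0]
            linarith
  have hsub : {ω | (G n ω).SatisfiesBrouwer}ᶜ ⊆
      {ω | ¬ HasSmallDeviations (δ * μ n * n ^ 2) ((G n ω).deviation (μ n))} :=
    fun ω hω hsmall =>
      hω ((G n ω).satisfiesBrouwer_of_deviation_le hγ0 hm0.le hm1 hnγ hsmall)
  -- Subadditivity of the outer measure spares the measurability of the Brouwer event.
  have h1 := measureReal_union_le (μ := P) {ω | (G n ω).SatisfiesBrouwer}
    {ω | (G n ω).SatisfiesBrouwer}ᶜ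
  rw [Set.union_compl_self, probReal_univ] at h1
  linarith [measureReal_mono (μ := P) hsub]
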